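/- Let $\mathcal X$ be a set of datasets with a symmetric neighboring relation, let $(\mathcal Y,\mathcal G)$ be a measurable space, and let $(A_n)_{n\ge1}$ be a sequence of algorithms: for each $x\in\mathcal X$, $(A_n(x))_{n\ge1}$ is a sequence of $\mathcal Y$-valued random variables on a probability space (which may depend on $x$). Write $A_{1:n}=(A_1,\dots,A_n)$. Let $\epsilon_n,\delta_n:\mathcal Y^{n-1}\to\mathbb R_{\ge0}$ be measurable, and write $\epsilon_n(x)=\epsilon_n(A_{1:n-1}(x))$, $\delta_n(x)=\delta_n(A_{1:n-1}(x))$. Suppose that, for every $n\ge1$, $A_n$ is $(\epsilon_n,\delta_n)$-differentially private conditioned on $A_{1:n-1}$, i.e. there are (versions of the regular) conditional distributions $\kappa_n^x(\cdot\mid z)$ of $A_n(x)$ given $A_{1:n-1}(x)=z$, for $x\in\mathcal X$, such that for all neighbors $x,x'$ and all $G\in\mathcal G$, almost surely, $$\kappa_n^x\big(G\mid A_{1:n-1}(x)\big)\le e^{\epsilon_n(x)}\,\kappa_n^{x'}\big(G\mid A_{1:n-1}(x)\big)+\delta_n(x).$$ Let $\epsilon>0$ and $\delta=\delta'+\delta''$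 with $\delta'>0$, $\delta''\ge0$. For nonnegative real sequences put $$N\big((\epsilon_n)_{n\ge1},(\delta_n)_{n\ge1}\big):=\inf\Big\{n\ge 0:\ \epsilon<\sqrt{2\log(1/\delta')\sum_{m\le n+1}\epsilon_m^2}+\tfrac12\sum_{m\le n+1}\epsilon_m^2\ \text{ or }\ \delta''<\sum_{m\le n+1}\delta_m\Big\}\in\mathbb N\cup\{\infty\}$$ (with $\inf\emptyset=\infty$ and, in case $\delta'>1$, the square root of a negative number read as $0$), and $N(x):=N((\epsilon_n(x))_{n\ge1},(\delta_n(x))_{n\ge1})$. Let $A_{1:N(x)}(x)=(A_1(x),\dots,A_{N(x)}(x),\square,\square,\dots)$, a random sequence in $(\mathcal Y\cup\{\square\})^{\infty}$ with the product $\sigma$-algebra, where $\square$ is an additional terminating symbol (which does not occur if $N(x)=\infty$). Then $N$ is an $(\epsilon,\delta)$-privacy filter: for every $x$, $N(x)$ is a stopping time with respect to the filtration $\mathcal F_n=\sigma(A_1(x),\dots,A_n(x))$, $n\ge0$, and the algorithm $A_{1:N(\cdot)}(\cdot)$ is $(\epsilon,\delta)$-differentially private, i.e. for all neighbors $x,x'$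 and all measurable sets $G$ of output sequences, $$\mathbb P\big(A_{1:N(x)}(x)\in G\big)\le e^{\epsilon}\,\mathbb P\big(A_{1:N(x')}(x')\in G\big)+\delta .$$ -/

import Mathlib

open MeasureTheory ProbabilityTheory
open scoped NNReal

namespace DiffPriv

noncomputable section

universe u v w z

/- Conventions. `X` is the set of datasets, with an arbitrary symmetric neighbouring relation
`Nbr`. For every dataset `x` there is a probability space `(Ω x, P x)`, and an algorithm with
outputs in a measurable space `Y` is a family of random variables `A x : Ω x → Y`. Sequences are
indexed from `0`: the entry of index `n` is the `(n+1)`-st algorithm (or parameter). -/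

/-- `(ε, δ)`-differential privacy of the algorithm `A`. -/
def IsDP {X : Type u} (Nbr : X → X → Prop) {Ω : X → Type v} [∀ x, MeasurableSpace (Ω x)]
    (P : ∀ x, Measure (Ω x)) {Y : Type w} [MeasurableSpace Y] (A : ∀ x, Ω x → Y)
    (ε δ : ℝ) : Prop :=
  ∀ x x', Nbr x x' → ∀ G : Set Y, MeasurableSet G →
    (P x).real (A x ⁻¹' G) ≤ Real.exp ε * (P x').real (A x' ⁻¹' G) + δ

/-- `(ε, δ)`-differential privacy of `A` conditioned on the algorithm `B`, where `ε` and `δ` are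
functions of the output of `B`. Here `κ x` is a (regular) conditional distribution of `A x` given
`B x`, and `ℙ(A(x') ∈ G ∣ B(x))` is the conditional probability of `A(x') ∈ G` given `B(x') = b`,
evaluated at the observed output `b = B(x)`. The inequality is between random variables on
`(Ω x, P x)` and is required almost surely, for every event `G`. -/
def IsCondDP {X : Type u} (Nbr : X → X → Prop) {Ω : X → Type v} [∀ x, MeasurableSpace (Ω x)]
    (P : ∀ x, Measure (Ω x)) {Y : Type w} [MeasurableSpace Y] {Z : Type z} [MeasurableSpace Z]
    (A : ∀ x, Ω x → Y) (B : ∀ x, Ω x → Z) (ε δ : Z → ℝ≥0) : Prop :=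
  ∃ κ : X → Kernel Z Y,
    (∀ x, IsMarkovKernel (κ x)) ∧
    (∀ x, HasCondDistrib (A x) (B x) (κ x) (P x)) ∧
    ∀ x x', Nbr x x' → ∀ G : Set Y, MeasurableSet G →
      ∀ᵐ ω ∂(P x), (κ x (B x ω)).real G ≤
        Real.exp (ε (B x ω)) * (κ x' (B x ω)).real G + δ (B x ω)

/-- The outputs of the first `n` algorithms. -/
def history {X : Type u} {Ω : X → Type v} {Y : Type w} (A : ℕ → ∀ x, Ω x → Y) (n : ℕ) (x : X)
    (ω : Ω x) : Fin n → Y :=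
  fun i => A i x ω

/-- The natural filtration of a sequence of random variables: its `n`-th σ-algebra is generated by
the first `n` variables (and is trivial for `n = 0`). -/
def naturalFiltration {Ω : Type v} [m : MeasurableSpace Ω] {Y : Type w} [mY : MeasurableSpace Y]
    (A : ℕ → Ω → Y) (hA : ∀ n, Measurable (A n)) : Filtration ℕ m where
  seq n := ⨆ i : Fin n, mY.comap (A i)
  mono' _ _ h := iSup_le fun i => le_iSup_of_le (Fin.castLE h i) le_rfl
  le' _ := iSup_le fun i => (hA i).comap_le

/-- The output sequence `A_{1:N}`: the outputs up to the random time `N`, followed by the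
terminating element `□ = Sum.inr ()` repeated forever (never, if `N = ∞`). -/
def stoppedOutput {Ω : Type v} {Y : Type w} (A : ℕ → Ω → Y) (N : Ω → ℕ∞) (ω : Ω) :
    ℕ → Y ⊕ Unit :=
  fun n => if (n : ℕ∞) < N ω then Sum.inl (A n ω) else Sum.inr ()

/-- The random time `N(x) = N((ε_n(x))_n, (δ_n(x))_n)`, where the parameters of the `(n+1)`-st
algorithm are computed from the outputs of the first `n` algorithms. -/
def adaptiveTime {X : Type u} {Ω : X → Type v} {Y : Type w} (A : ℕ → ∀ x, Ω x → Y)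
    (εs δs : ∀ n : ℕ, (Fin n → Y) → ℝ≥0) (N : (ℕ → ℝ≥0) → (ℕ → ℝ≥0) → ℕ∞) (x : X)
    (ω : Ω x) : ℕ∞ :=
  N (fun n => εs n (history A n x ω)) (fun n => δs n (history A n x ω))

/-- `N` is an `(ε, δ)`-privacy filter for the adaptive sequence of algorithms `A`. -/
structure IsPrivacyFilter {X : Type u} (Nbr : X → X → Prop) {Ω : X → Type v}
    [∀ x, MeasurableSpace (Ω x)] (P : ∀ x, Measure (Ω x)) {Y : Type w} [MeasurableSpace Y]
    (A : ℕ → ∀ x, Ω x → Y) (hA : ∀ n x, Measurable (A n x))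
    (εs δs : ∀ n : ℕ, (Fin n → Y) → ℝ≥0) (ε δ : ℝ)
    (N : (ℕ → ℝ≥0) → (ℕ → ℝ≥0) → ℕ∞) : Prop where
  isStoppingTime : ∀ x, IsStoppingTime
    (naturalFiltration (fun n => A n x) fun n => hA n x) (adaptiveTime A εs δs N x)
  measurable_stoppedOutput : ∀ x,
    Measurable (stoppedOutput (fun n => A n x) (adaptiveTime A εs δs N x))
  isDP : IsDP Nbr P (fun x => stoppedOutput (fun n => A n x) (adaptiveTime A εs δs N x)) ε δ

/-- The stopping rule: the least `n ≥ 0` for which the parameters of the first `n + 1` algorithms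
exceed one of the two budgets, and `∞` if there is no such `n`. -/
def filterTime (ε δ' δ'' : ℝ) (e d : ℕ → ℝ≥0) : ℕ∞ :=
  sInf ((fun n : ℕ => (n : ℕ∞)) '' {n : ℕ |
    ε < √(2 * Real.log (1 / δ') * ∑ m ∈ Finset.range (n + 1), (e m : ℝ) ^ 2)
        + 1 / 2 * ∑ m ∈ Finset.range (n + 1), (e m : ℝ) ^ 2 ∨
    δ'' < ∑ m ∈ Finset.range (n + 1), (d m : ℝ)})

end

end DiffPriv

/-!
Fix neighbours `x, x'` and Hölder conjugate exponents `a, b`. The proof propagates inequalities of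
the form `ℙ_x(G) ≤ δ'' + K * ℙ_{x'}(G) ^ (1 / b)`, a version of Rényi differential privacy with an
additive error, backwards along the histories.

For a single step, let `p` and `q` be the two conditional distributions, which satisfy the
`(e, d)`-privacy inequality in both directions. By a Neyman–Pearson argument the worst case is
randomized response: for every `h` with values in `[0, 1]` one has `∫ h ∂p ≤ d + ∫ w * h ∂q`, where
`w` has `q`-mean `1` and values in `[exp (-e), exp e]`. The `a`-th moment of such a `w` is at most
`cosh ((a - 1/2) e) / cosh (e / 2) ≤ exp (a (a - 1) e² / 2)`, and Hölder's inequality gives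
`∫ h ∂p ≤ d + exp ((a - 1) e² / 2) * (∫ h ^ b ∂q) ^ (1 / b)` (`integral_le_of_cdf_le`).

In the adaptive setting, a bound after step `n + 1` with the error `d` and the constant
`exp ((a - 1) s / 2)` thus becomes a bound after step `n` with `d + δ_n` and
`exp ((a - 1) (s + ε_n²) / 2)`, i.e. the steps are charged to the budgets for `∑ ε_n²` and
`∑ δ_n`, and the filter stops before these are exceeded (`integral_history_le`). The argument treats
one pair of test functions at a time and uses no densities of kernels; therefore `Y` need not be
countably generated (`ae_forall_measureReal_preimage_le`). Neither of the two laws of the history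
need be absolutely continuous with respect to the other, which
`exists_conditional_bound` deals with by choosing versions of the conditional expectations.

If `r² = s` is the largest value of `∑ ε_n²` that the filter admits, then the choice
`a = 1 + g / r`, `g = √(2 log (1 / δ'))`, turns the resulting bound into
`ℙ_x(G) ≤ exp ε * ℙ_{x'}(G) + δ' + δ''` by weighted AM–GM (`exp_mul_rpow_le`). This is for events
`G` that depend on finitely many outputs, and approximation gives all events.
-/

namespace DiffPriv

/-! ### The moments of randomized response -/

lemma sinh_le_mul_cosh {x : ℝ} (hx : 0 ≤ x) : Real.sinh x ≤ x * Real.cosh x := by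
  have h : MonotoneOn (fun x : ℝ => x * Real.cosh x - Real.sinh x) (Set.Ici 0) := by
    apply monotoneOn_of_deriv_nonneg (convex_Ici 0) (by fun_prop) (by fun_prop)
    intro x hx
    rw [interior_Ici] at hx
    have : HasDerivAt (fun x : ℝ => x * Real.cosh x - Real.sinh x)
        (1 * Real.cosh x + x * Real.sinh x - Real.cosh x) x :=
      ((hasDerivAt_id x).mul (Real.hasDerivAt_cosh x)).sub (Real.hasDerivAt_sinh x)
    rw [this.deriv]
    have := mul_nonneg (le_of_lt hx) (Real.sinh_nonneg_iff.2 (le_of_lt hx))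
    linarith
  have := h (Set.mem_Ici.2 le_rfl) (Set.mem_Ici.2 hx) hx
  simp at this
  linarith

lemma antitoneOn_cosh_mul_exp :
    AntitoneOn (fun x : ℝ => Real.cosh x * Real.exp (-(x ^ 2 / 2))) (Set.Ici 0) := by
  apply antitoneOn_of_deriv_nonpos (convex_Ici 0) (by fun_prop) (by fun_prop)
  intro x hx
  rw [interior_Ici] at hx
  have h1 : HasDerivAt (fun x : ℝ => -(x ^ 2 / 2)) (-x) x := by
    exact (((hasDerivAt_pow 2 x).div_const 2).neg).congr_deriv (by norm_num)
  have h2 := (Real.hasDerivAt_cosh x).mul h1.exp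
  have h3 : deriv (fun x : ℝ => Real.cosh x * Real.exp (-(x ^ 2 / 2))) x = _ := h2.deriv
  rw [h3]
  have := sinh_le_mul_cosh (le_of_lt hx)
  have := mul_le_mul_of_nonneg_right this (Real.exp_pos (-(x ^ 2 / 2))).le
  nlinarith

/-- The left-hand side is the `a`-th moment of the likelihood ratio of randomized response, which
equals `exp (-e)` or `exp e` and has mean `1`. It simplifies to `cosh ((a - 1/2) e) / cosh (e / 2)`,
so that the bound is the monotonicity of `cosh x * exp (-x ^ 2 / 2)` between `e / 2` and
`(a - 1/2) e`. -/
lemma randomizedResponse_moment_le {a e : ℝ} (ha : 1 ≤ a) (he : 0 ≤ e) :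
    (1 - 1 / (Real.exp e + 1)) * Real.exp (-e) ^ a + 1 / (Real.exp e + 1) * Real.exp e ^ a
      ≤ Real.exp (a * (a - 1) * e ^ 2 / 2) := by
  have h := antitoneOn_cosh_mul_exp (a := e / 2) (b := (a - 1 / 2) * e)
    (Set.mem_Ici.2 (by positivity)) (Set.mem_Ici.2 (mul_nonneg (by linarith) he))
    (by nlinarith)
  simp only at h
  have h1 : Real.cosh ((a - 1 / 2) * e) ≤
      Real.cosh (e / 2) * Real.exp (a * (a - 1) * e ^ 2 / 2) := by
    have := mul_le_mul_of_nonneg_right h (Real.exp_pos (((a - 1 / 2) * e) ^ 2 / 2)).le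
    rw [mul_assoc, mul_assoc, ← Real.exp_add, ← Real.exp_add] at this
    rw [neg_add_cancel, Real.exp_zero, mul_one] at this
    refine this.trans_eq ?_
    congr 2; ring
  rw [← Real.exp_mul, ← Real.exp_mul]
  have hE : Real.exp e + 1 = 2 * Real.exp (e / 2) * Real.cosh (e / 2) := by
    rw [Real.cosh_eq]
    have : Real.exp e = Real.exp (e / 2) * Real.exp (e / 2) := by
      rw [← Real.exp_add]; congr 1; ring
    have h0 : Real.exp (e / 2) * Real.exp (-(e / 2)) = 1 := by
      rw [← Real.exp_add]; simp
    rw [this]; linear_combination - h0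
  have h2 : Real.exp e * Real.exp (-e * a) + Real.exp (e * a) =
      2 * Real.exp (e / 2) * Real.cosh ((a - 1 / 2) * e) := by
    rw [Real.cosh_eq, mul_div_assoc', mul_assoc, mul_add, ← Real.exp_add, ← Real.exp_add,
      ← Real.exp_add]
    ring_nf
  have h3 : (1 - 1 / (Real.exp e + 1)) * Real.exp (-e * a) + 1 / (Real.exp e + 1) *
      Real.exp (e * a) =
        (Real.exp e * Real.exp (-e * a) + Real.exp (e * a)) / (Real.exp e + 1) := by
    have : Real.exp e + 1 ≠ 0 := by positivity
    field_simp
    ring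
  rw [h3, h2, div_le_iff₀ (by positivity), hE]
  have := mul_le_mul_of_nonneg_left h1 (by positivity : 0 ≤ 2 * Real.exp (e / 2))
  linarith

/-! ### One private step: comparing the integrals of one function -/

section Measure

variable {Y : Type*} [MeasurableSpace Y]

lemma integrable_of_mem_Icc {μ : Measure Y} [IsFiniteMeasure μ] {f : Y → ℝ} {C : ℝ}
    (hf : Measurable f) (h0 : ∀ y, 0 ≤ f y) (h1 : ∀ y, f y ≤ C) : Integrable f μ :=
  Integrable.of_mem_Icc 0 C hf.aemeasurable (ae_of_all _ fun y => ⟨h0 y, h1 y⟩)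

lemma exists_quantile (q : Measure Y) [IsProbabilityMeasure q] {h : Y → ℝ} (hm : Measurable h)
    (h0 : ∀ y, 0 ≤ h y) (h1 : ∀ y, h y ≤ 1) {u : ℝ} (hu0 : 0 ≤ u) (hu1 : u ≤ 1) :
    ∃ c, 0 ≤ c ∧ c ≤ 1 ∧ q.real {y | c < h y} ≤ u ∧ u ≤ q.real {y | c ≤ h y} := by
  set S : Set ℝ := {t | t ≤ 1 ∧ u ≤ q.real {y | t ≤ h y}} with hS
  have hS0 : (0 : ℝ) ∈ S := by
    refine ⟨zero_le_one, ?_⟩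
    simp [h0, hu1]
  have hSb : BddAbove S := ⟨1, fun t ht => ht.1⟩
  have hc0 : 0 ≤ sSup S := le_csSup hSb hS0
  have hc1 : sSup S ≤ 1 := csSup_le ⟨0, hS0⟩ fun t ht => ht.1
  refine ⟨sSup S, hc0, hc1, ?_, ?_⟩
  · have hU : {y | sSup S < h y} = ⋃ n : ℕ, {y | sSup S + 1 / ((n : ℝ) + 1) ≤ h y} := by
      ext y
      simp only [Set.mem_ofPred_eq, Set.mem_iUnion]
      constructor
      · intro hy
        obtain ⟨n, hn⟩ := exists_nat_one_div_lt (sub_pos.2 hy)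
        exact ⟨n, by linarith⟩
      · rintro ⟨n, hn⟩
        have : (0 : ℝ) < 1 / ((n : ℝ) + 1) := by positivity
        linarith
    have hmono : Monotone fun n : ℕ => {y | sSup S + 1 / ((n : ℝ) + 1) ≤ h y} := by
      intro n m hnm y hy
      have : 1 / ((m : ℝ) + 1) ≤ 1 / ((n : ℝ) + 1) := Nat.one_div_le_one_div hnm
      simp only [Set.mem_ofPred_eq] at hy ⊢
      linarith
    have ht := (ENNReal.tendsto_toReal (measure_ne_top q _)).comp
      (tendsto_measure_iUnion_atTop (μ := q) hmono)
    rw [← hU] at ht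
    refine le_of_tendsto ht (Filter.Eventually.of_forall fun n => ?_)
    by_contra! hlt
    have hn : (0 : ℝ) < 1 / ((n : ℝ) + 1) := by positivity
    by_cases hle : sSup S + 1 / ((n : ℝ) + 1) ≤ 1
    · have : sSup S + 1 / ((n : ℝ) + 1) ≤ sSup S := le_csSup hSb ⟨hle, hlt.le⟩
      linarith
    · have he : {y | sSup S + 1 / ((n : ℝ) + 1) ≤ h y} = ∅ := by
        ext y
        have := h1 y
        simp only [Set.mem_ofPred_eq, Set.mem_empty_iff_false, iff_false]
        intro h'
        linarith
      simp only [Function.comp_apply, he, measure_empty, ENNReal.toReal_zero] at hlt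
      linarith
  · have hI : {y | sSup S ≤ h y} = ⋂ n : ℕ, {y | sSup S - 1 / ((n : ℝ) + 1) ≤ h y} := by
      ext y
      simp only [Set.mem_ofPred_eq, Set.mem_iInter]
      constructor
      · intro hy n
        have : (0 : ℝ) < 1 / ((n : ℝ) + 1) := by positivity
        linarith
      · intro hn
        by_contra! hy
        obtain ⟨n, hn'⟩ := exists_nat_one_div_lt (sub_pos.2 hy)
        linarith [hn n]
    have hanti : Antitone fun n : ℕ => {y | sSup S - 1 / ((n : ℝ) + 1) ≤ h y} := by
      intro n m hnm y hy
      have : 1 / ((m : ℝ) + 1) ≤ 1 / ((n : ℝ) + 1) := Nat.one_div_le_one_div hnm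
      simp only [Set.mem_ofPred_eq] at hy ⊢
      linarith
    have ht := (ENNReal.tendsto_toReal (measure_ne_top q _)).comp
      (tendsto_measure_iInter_atTop (μ := q)
        (fun n => (measurableSet_le measurable_const hm).nullMeasurableSet) hanti
        ⟨0, measure_ne_top _ _⟩)
    rw [← hI] at ht
    refine ge_of_tendsto ht (Filter.Eventually.of_forall fun n => ?_)
    have hn : (0 : ℝ) < 1 / ((n : ℝ) + 1) := by positivity
    obtain ⟨t, htS, hlt⟩ := exists_lt_of_lt_csSup ⟨0, hS0⟩ (sub_lt_self (sSup S) hn)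
    refine htS.2.trans (measureReal_mono fun y hy => ?_)
    simp only [Set.mem_ofPred_eq] at hy ⊢
    linarith

/-- A randomized threshold test of level `u`, as in the Neyman–Pearson lemma: `v` is `1` where
`h > c`, `0` where `h < c`, and a constant where `h = c`. The last clause encodes the first two. -/
lemma exists_thresholdTest (q : Measure Y) [IsProbabilityMeasure q] {h : Y → ℝ}
    (hm : Measurable h) (h0 : ∀ y, 0 ≤ h y) (h1 : ∀ y, h y ≤ 1) {u : ℝ} (hu0 : 0 ≤ u)
    (hu1 : u ≤ 1) :
    ∃ c, 0 ≤ c ∧ c ≤ 1 ∧ ∃ v : Y → ℝ, Measurable v ∧ (∀ y, 0 ≤ v y) ∧ (∀ y, v y ≤ 1) ∧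
      ∫ y, v y ∂q = u ∧ ∀ y, v y * (h y - c) = max (h y - c) 0 := by
  obtain ⟨c, hc0, hc1, hlt, hle⟩ := exists_quantile q hm h0 h1 hu0 hu1
  obtain ⟨a, b, ha, hb, hab, hu⟩ : u ∈ segment ℝ (q.real {y | c < h y}) (q.real {y | c ≤ h y}) := by
    rw [segment_eq_Icc (hlt.trans hle)]
    exact ⟨hlt, hle⟩
  have hm1 : MeasurableSet {y | c < h y} := measurableSet_lt measurable_const hm
  have hm2 : MeasurableSet {y | c ≤ h y} := measurableSet_le measurable_const hm
  have hv : ∀ y, (h y < c ∧ a * {y | c < h y}.indicator 1 y + b * {y | c ≤ h y}.indicator 1 y = 0) ∨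
      (h y = c ∧ a * {y | c < h y}.indicator 1 y + b * {y | c ≤ h y}.indicator 1 y = b) ∨
      (c < h y ∧ a * {y | c < h y}.indicator 1 y + b * {y | c ≤ h y}.indicator 1 y = 1) := by
    intro y
    rcases lt_trichotomy (h y) c with hy | hy | hy
    · exact Or.inl ⟨hy, by simp [Set.indicator, hy.not_gt, hy.not_ge]⟩
    · exact Or.inr (Or.inl ⟨hy, by simp [Set.indicator, hy]⟩)
    · exact Or.inr (Or.inr ⟨hy, by simp [Set.indicator, hy, hy.le, hab]⟩)
  refine ⟨c, hc0, hc1, fun y => a * {y | c < h y}.indicator 1 y + b * {y | c ≤ h y}.indicator 1 y,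
    ?_, ?_, ?_, ?_, ?_⟩
  · exact ((measurable_one.indicator hm1).const_mul a).add
      ((measurable_one.indicator hm2).const_mul b)
  · intro y
    rcases hv y with h | h | h <;> simp only [h.2] <;> linarith
  · intro y
    rcases hv y with h | h | h <;> simp only [h.2] <;> linarith
  · rw [integral_add, integral_const_mul, integral_const_mul, integral_indicator_one hm1,
      integral_indicator_one hm2]
    · exact hu
    · exact ((integrable_const (1 : ℝ)).indicator hm1).const_mul a
    · exact ((integrable_const (1 : ℝ)).indicator hm2).const_mul b
  · intro y
    rcases hv y with ⟨h, h'⟩ | ⟨h, h'⟩ | ⟨h, h'⟩ <;> simp only [h']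
    · rw [max_eq_right (by linarith)]; ring
    · rw [h]; simp
    · rw [max_eq_left (by linarith)]; ring

/-- Integrated over the levels, the privacy inequality passes from superlevel sets to functions;
the additive error is scaled by the length `M` of the range. -/
lemma integral_le_of_superlevel_le {p q : Measure Y} [IsProbabilityMeasure p]
    [IsProbabilityMeasure q] {k : Y → ℝ} (hk : Measurable k) {M a d : ℝ} (hM : 0 ≤ M)
    (hk0 : ∀ y, 0 ≤ k y) (hkM : ∀ y, k y ≤ M)
    (h : ∀ t, 0 < t → p.real {y | t ≤ k y} ≤ a * q.real {y | t ≤ k y} + d) :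
    ∫ y, k y ∂p ≤ a * ∫ y, k y ∂q + d * M := by
  have hi : ∀ (μ : Measure Y) [IsProbabilityMeasure μ],
      IntegrableOn (fun t => μ.real {y | t ≤ k y}) (Set.Ioc 0 M) := by
    intro μ _
    have hanti : Antitone fun t => μ.real {y | t ≤ k y} := fun s t hst =>
      measureReal_mono fun y (hy : t ≤ k y) => hst.trans hy
    exact ((hanti.antitoneOn _).integrableOn_isCompact isCompact_Icc).mono_set
      Set.Ioc_subset_Icc_self
  have hf : ∀ (μ : Measure Y) [IsProbabilityMeasure μ],
      ∫ y, k y ∂μ = ∫ t in Set.Ioc 0 M, μ.real {y | t ≤ k y} := fun μ _ =>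
    (integrable_of_mem_Icc hk hk0 hkM).integral_eq_integral_Ioc_meas_le
      (ae_of_all _ hk0) (ae_of_all _ hkM)
  have h2 : ∫ t in Set.Ioc 0 M, p.real {y | t ≤ k y} ≤
      ∫ t in Set.Ioc 0 M, (a * q.real {y | t ≤ k y} + d) :=
    setIntegral_mono_on (hi p) (((hi q).const_mul a).add (integrable_const d)) measurableSet_Ioc
      fun t ht => h t ht.1
  rw [hf p, hf q]
  refine h2.trans (le_of_eq ?_)
  rw [integral_add ((hi q).const_mul a) (integrable_const d), integral_const_mul]
  simp [hM, mul_comm]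

/-- The one-step estimate. If `p` and `q` satisfy the `(e, d)`-privacy inequalities, in both
directions, on the half-lines of `h`, then randomized response is the worst case: `∫ h ∂p` is at
most `d + ∫ w * h ∂q` for a density `w` of `q`-mean `1` with values in `[exp (-e), exp e]`. Hölder's
inequality and the moment bound for `w` give the claim. -/
lemma integral_le_of_cdf_le {p q : Measure Y} [IsProbabilityMeasure p] [IsProbabilityMeasure q]
    {h : Y → ℝ} (hm : Measurable h) (h0 : ∀ y, 0 ≤ h y) (h1 : ∀ y, h y ≤ 1) {e d a b : ℝ}
    (he : 0 ≤ e) (hd : 0 ≤ d) (hab : a.HolderConjugate b)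
    (hpq : ∀ t, p.real {y | t ≤ h y} ≤ Real.exp e * q.real {y | t ≤ h y} + d)
    (hqp : ∀ t, q.real {y | h y ≤ t} ≤ Real.exp e * p.real {y | h y ≤ t} + d) :
    ∫ y, h y ∂p ≤ d + Real.exp ((a - 1) * e ^ 2 / 2) * (∫ y, h y ^ b ∂q) ^ (1 / b) := by
  have hu0 : 0 ≤ 1 / (Real.exp e + 1) := by positivity
  have hu1 : 1 / (Real.exp e + 1) ≤ 1 := by
    rw [div_le_one (by positivity)]
    linarith [Real.exp_pos e]
  -- The level `1 / (exp e + 1)` is the one for which the density `w` below has mean `1`.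
  obtain ⟨c, hc0, hc1, v, hvm, hv0, hv1, hvu, hvh⟩ := exists_thresholdTest q hm h0 h1 hu0 hu1
  set E := Real.exp e with hE
  have hEp : 0 < E := Real.exp_pos e
  have hE1 : 1 ≤ E := Real.one_le_exp he
  set E' := Real.exp (-e) with hE'
  have hEE : E * E' = 1 := by rw [hE, hE', ← Real.exp_add]; simp
  have hE'p : 0 < E' := Real.exp_pos _
  have hE'1 : E' ≤ 1 := Real.exp_le_one_iff.2 (by linarith)
  set u := 1 / (E + 1) with hu
  have huE : u * (E + 1) = 1 := by rw [hu]; field_simp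
  set w : Y → ℝ := fun y => E' * (1 - v y) + E * v y with hw
  have hw0 : ∀ y, 0 ≤ w y := fun y =>
    add_nonneg (mul_nonneg hE'p.le (by linarith [hv1 y])) (mul_nonneg hEp.le (hv0 y))
  have hwE : ∀ y, w y ≤ E := fun y => by
    have := mul_nonneg (by linarith : 0 ≤ E - E') (by linarith [hv1 y] : 0 ≤ 1 - v y)
    simp only [hw]
    nlinarith
  have hwm : Measurable w := ((hvm.const_sub 1).const_mul E').add (hvm.const_mul E)
  have hpos0 : ∀ y, 0 ≤ max (h y - c) 0 := fun y => le_max_right _ _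
  have hpos1 : ∀ y, max (h y - c) 0 ≤ 1 - c := fun y => max_le (by linarith [h1 y]) (by linarith)
  have hneg0 : ∀ y, 0 ≤ max (c - h y) 0 := fun y => le_max_right _ _
  have hneg1 : ∀ y, max (c - h y) 0 ≤ c := fun y => max_le (by linarith [h0 y]) (by linarith)
  have hposm : Measurable fun y => max (h y - c) 0 := (hm.sub_const c).max measurable_const
  have hnegm : Measurable fun y => max (c - h y) 0 := (hm.const_sub c).max measurable_const
  have F1 : ∫ y, max (h y - c) 0 ∂p ≤ E * ∫ y, max (h y - c) 0 ∂q + d * (1 - c) := by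
    refine integral_le_of_superlevel_le hposm (by linarith) hpos0 hpos1 fun t ht => ?_
    have : {y | t ≤ max (h y - c) 0} = {y | c + t ≤ h y} := by
      ext y
      simp only [Set.mem_ofPred_eq, le_max_iff, ht.not_ge, or_false]
      exact le_sub_iff_add_le'
    rw [this]
    exact hpq _
  have F2 : ∫ y, max (c - h y) 0 ∂q ≤ E * ∫ y, max (c - h y) 0 ∂p + d * c := by
    refine integral_le_of_superlevel_le hnegm hc0 hneg0 hneg1 fun t ht => ?_
    have : {y | t ≤ max (c - h y) 0} = {y | h y ≤ c - t} := by
      ext y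
      simp only [Set.mem_ofPred_eq, le_max_iff, ht.not_ge, or_false]
      exact le_sub_comm
    rw [this]
    exact hqp _
  have hsplit : ∀ (μ : Measure Y) [IsProbabilityMeasure μ],
      ∫ y, h y ∂μ = c + ∫ y, max (h y - c) 0 ∂μ - ∫ y, max (c - h y) 0 ∂μ := by
    intro μ _
    have hi1 : Integrable (fun y => max (h y - c) 0) μ := integrable_of_mem_Icc hposm hpos0 hpos1
    have hi2 : Integrable (fun y => max (c - h y) 0) μ := integrable_of_mem_Icc hnegm hneg0 hneg1
    have hi3 : Integrable (fun y => c + max (h y - c) 0) μ := (integrable_const c).add hi1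
    have heq : ∀ y, h y = c + max (h y - c) 0 - max (c - h y) 0 := fun y => by
      rcases le_total (h y) c with hy | hy
      · rw [max_eq_right (by linarith), max_eq_left (by linarith)]; ring
      · rw [max_eq_left (by linarith), max_eq_right (by linarith)]; ring
    rw [integral_congr_ae (ae_of_all _ heq), integral_sub hi3 hi2,
      integral_add (integrable_const c) hi1]
    simp
  have hwh : ∫ y, w y * h y ∂q =
      E' * ∫ y, h y ∂q + (E - E') * (∫ y, max (h y - c) 0 ∂q + c * u) := by
    have hi1 : Integrable (fun y => max (h y - c) 0) q := integrable_of_mem_Icc hposm hpos0 hpos1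
    have hi2 : Integrable v q := integrable_of_mem_Icc hvm hv0 hv1
    have hi3 : Integrable h q := integrable_of_mem_Icc hm h0 h1
    have hi4 : Integrable (fun y => max (h y - c) 0 + c * v y) q := hi1.add (hi2.const_mul c)
    have heq : ∀ y, w y * h y = E' * h y + (E - E') * (max (h y - c) 0 + c * v y) := fun y => by
      rw [← hvh y]
      simp only [hw]
      ring
    rw [integral_congr_ae (ae_of_all _ heq), integral_add (hi3.const_mul _) (hi4.const_mul _),
      integral_const_mul, integral_const_mul, integral_add hi1 (hi2.const_mul c),
      integral_const_mul, hvu]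
  -- The part of `h` above `c` is bounded by the inequality for `p`, and the part below `c` by the
  -- inequality for `q`, applied to the complement `(c - h)⁺`.
  have key : ∫ y, h y ∂p ≤ d + ∫ y, w y * h y ∂q := by
    have hE2 : (E - E') * u = 1 - E' := by
      linear_combination (1 - E') * huE + u * hEE
    rw [hwh, hsplit q, hsplit p]
    have F2' := mul_le_mul_of_nonneg_left F2 hE'p.le
    have : E' * (E * ∫ y, max (c - h y) 0 ∂p + d * c) =
        ∫ y, max (c - h y) 0 ∂p + E' * d * c := by
      linear_combination (∫ y, max (c - h y) 0 ∂p) * hEE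
    have h3 : E' * d * c ≤ d * c := by
      have := mul_nonneg (mul_nonneg (by linarith : 0 ≤ 1 - E') hd) hc0
      linarith
    have h4 : (E - E') * (c * u) = c * (1 - E') := by linear_combination c * hE2
    rw [mul_add (E - E'), h4]
    linarith
  have ha : 0 < a := hab.pos
  have hol : ∫ y, w y * h y ∂q ≤ (∫ y, w y ^ a ∂q) ^ (1 / a) * (∫ y, h y ^ b ∂q) ^ (1 / b) := by
    refine integral_mul_le_Lp_mul_Lq_of_nonneg hab (ae_of_all _ hw0) (ae_of_all _ h0) ?_ ?_
    · exact MemLp.of_bound hwm.aestronglyMeasurable E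
        (ae_of_all _ fun y => by rw [Real.norm_of_nonneg (hw0 y)]; exact hwE y)
    · exact MemLp.of_bound hm.aestronglyMeasurable 1
        (ae_of_all _ fun y => by rw [Real.norm_of_nonneg (h0 y)]; exact h1 y)
  have hmom : ∫ y, w y ^ a ∂q ≤ Real.exp (a * (a - 1) * e ^ 2 / 2) := by
    refine le_trans ?_ (randomizedResponse_moment_le hab.lt.le he)
    rw [← hE, ← hE', ← hu]
    have hi2 : Integrable v q := integrable_of_mem_Icc hvm hv0 hv1
    have hi3 : Integrable (fun y => 1 - v y) q := (integrable_const 1).sub hi2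
    have hi : Integrable (fun y => (1 - v y) * E' ^ a + v y * E ^ a) q :=
      (hi3.mul_const _).add (hi2.mul_const _)
    -- By convexity `w ^ a` lies below the chord between the extreme values of `w`.
    have hle : ∫ y, w y ^ a ∂q ≤ ∫ y, ((1 - v y) * E' ^ a + v y * E ^ a) ∂q := by
      refine integral_mono ?_ hi fun y => ?_
      · exact integrable_of_mem_Icc (hwm.pow_const a) (fun y => Real.rpow_nonneg (hw0 y) a)
          (fun y => Real.rpow_le_rpow (hw0 y) (hwE y) ha.le)
      · have := (convexOn_rpow hab.lt.le).2 (Set.mem_Ici.2 hE'p.le) (Set.mem_Ici.2 hEp.le)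
          (by linarith [hv1 y] : 0 ≤ 1 - v y) (hv0 y) (by ring)
        simp only [smul_eq_mul] at this
        simpa only [hw, mul_comm E', mul_comm E] using this
    refine hle.trans_eq ?_
    rw [integral_add (hi3.mul_const _) (hi2.mul_const _),
      integral_mul_const, integral_mul_const, integral_sub (integrable_const 1) hi2, hvu]
    simp
  refine key.trans ?_
  gcongr
  refine hol.trans ?_
  have hI : 0 ≤ (∫ y, h y ^ b ∂q) ^ (1 / b) :=
    Real.rpow_nonneg (integral_nonneg fun y => Real.rpow_nonneg (h0 y) b) _
  refine mul_le_mul_of_nonneg_right ?_ hI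
  calc (∫ y, w y ^ a ∂q) ^ (1 / a) ≤ Real.exp (a * (a - 1) * e ^ 2 / 2) ^ (1 / a) :=
        Real.rpow_le_rpow (integral_nonneg fun y => Real.rpow_nonneg (hw0 y) a) hmom
          (by positivity)
    _ = Real.exp ((a - 1) * e ^ 2 / 2) := by
        rw [← Real.exp_mul]
        congr 1
        field_simp

end Measure

/-! ### From single events to families of events -/

lemma measureReal_le_of_isSetAlgebra {Y : Type*} [m : MeasurableSpace Y] {p q : Measure Y}
    [IsFiniteMeasure p] [IsFiniteMeasure q] {𝒜 : Set (Set Y)} (h𝒜 : IsSetAlgebra 𝒜)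
    (hgen : m = MeasurableSpace.generateFrom 𝒜) {a d : ℝ} (ha : 0 ≤ a)
    (h : ∀ G ∈ 𝒜, p.real G ≤ a * q.real G + d) {G : Set Y} (hG : MeasurableSet G) :
    p.real G ≤ a * q.real G + d := by
  refine le_of_forall_pos_le_add fun η hη => ?_
  have hη' : 0 < η / (1 + a) := by positivity
  obtain ⟨t, ht, hlt⟩ := (Measure.MeasureDense.of_generateFrom_isSetAlgebra_finite (p + q) h𝒜
    hgen).approx G hG (measure_ne_top _ _) _ hη'
  have hd : (p + q).real (symmDiff G t) ≤ η / (1 + a) :=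
    ENNReal.toReal_le_of_le_ofReal hη'.le hlt.le
  rw [measureReal_add_apply] at hd
  have h1 : p.real G ≤ p.real t + p.real (symmDiff G t) := by
    refine (measureReal_mono ?_).trans (measureReal_union_le _ _)
    intro y hy
    by_cases hyt : y ∈ t
    · exact Or.inl hyt
    · exact Or.inr (Or.inl ⟨hy, hyt⟩)
  have h2 : q.real t ≤ q.real G + q.real (symmDiff G t) := by
    refine (measureReal_mono ?_).trans (measureReal_union_le _ _)
    intro y hy
    by_cases hyt : y ∈ G
    · exact Or.inl hyt
    · exact Or.inr (Or.inr ⟨hy, hyt⟩)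
  have h3 := h t ht
  have h4 := mul_le_mul_of_nonneg_left h2 ha
  have hp : 0 ≤ p.real (symmDiff G t) := measureReal_nonneg
  have hq : 0 ≤ q.real (symmDiff G t) := measureReal_nonneg
  have h5 : (1 + a) * (p.real (symmDiff G t) + q.real (symmDiff G t)) ≤ η := by
    rw [le_div_iff₀ (by positivity)] at hd
    linarith
  nlinarith [mul_nonneg ha hp]

variable {Z Y : Type*}

/-- A measurable subset of a product involves only countably many measurable subsets of the second
factor, whether or not the σ-algebra of that factor is countably generated. -/
lemma exists_countable_measurableSet_prod [mZ : MeasurableSpace Z] [mY : MeasurableSpace Y]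
    {S : Set (Z × Y)} (hS : MeasurableSet S) :
    ∃ 𝒞 : Set (Set Y), 𝒞.Countable ∧ (∀ G ∈ 𝒞, MeasurableSet G) ∧
      MeasurableSet[mZ.prod (MeasurableSpace.generateFrom 𝒞)] S := by
  rw [← generateFrom_prod] at hS
  induction S, hS using MeasurableSpace.generateFrom_induction with
  | hC t ht _ =>
    obtain ⟨H, hH, G, hG, rfl⟩ := ht
    refine ⟨{G}, Set.countable_singleton G, by simpa using hG, ?_⟩
    exact @MeasurableSet.prod _ _ mZ (MeasurableSpace.generateFrom {G}) _ _ hH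
      (MeasurableSpace.measurableSet_generateFrom rfl)
  | empty => exact ⟨∅, Set.countable_empty, by simp, @MeasurableSet.empty _ (_)⟩
  | compl t _ ih =>
    obtain ⟨𝒞, h1, h2, h3⟩ := ih
    exact ⟨𝒞, h1, h2, h3.compl⟩
  | iUnion s _ ih =>
    choose 𝒞 h1 h2 h3 using ih
    refine ⟨⋃ n, 𝒞 n, Set.countable_iUnion h1, ?_, MeasurableSet.iUnion fun n => ?_⟩
    · intro G hG
      obtain ⟨n, hn⟩ := Set.mem_iUnion.1 hG
      exact h2 n G hn
    · refine (sup_le_sup le_rfl (MeasurableSpace.comap_mono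
        (MeasurableSpace.generateFrom_mono (Set.subset_iUnion 𝒞 n)))) _ (h3 n)

lemma exists_countable_measurable_prod [mZ : MeasurableSpace Z] [mY : MeasurableSpace Y]
    {f : Z × Y → ℝ} (hf : Measurable f) :
    ∃ 𝒞 : Set (Set Y), 𝒞.Countable ∧ (∀ G ∈ 𝒞, MeasurableSet G) ∧
      Measurable[mZ.prod (MeasurableSpace.generateFrom 𝒞)] f := by
  choose 𝒞 h1 h2 h3 using fun r : ℚ =>
    exists_countable_measurableSet_prod (hf (measurableSet_Iio (a := (r : ℝ))))
  refine ⟨⋃ r, 𝒞 r, Set.countable_iUnion h1, ?_, ?_⟩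
  · intro G hG
    obtain ⟨n, hn⟩ := Set.mem_iUnion.1 hG
    exact h2 n G hn
  · rw [BorelSpace.measurable_eq (α := ℝ), Real.borel_eq_generateFrom_Iio_rat]
    refine @measurable_generateFrom _ _ (_) _ _ fun t ht => ?_
    obtain ⟨r, rfl⟩ : ∃ r : ℚ, t = Set.Iio (r : ℝ) := by simpa [eq_comm] using ht
    exact (sup_le_sup le_rfl (MeasurableSpace.comap_mono
        (MeasurableSpace.generateFrom_mono (Set.subset_iUnion 𝒞 r)))) _ (h3 r)

/-- In conditional privacy the exceptional null set depends on the event. For the events described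
by one measurable function `f` there is a common null set, even though the Borel set `B` may be
chosen depending on `z`: all sections of `f` are measurable for one countably generated
σ-algebra. -/
lemma ae_forall_measureReal_preimage_le [mZ : MeasurableSpace Z] [mY : MeasurableSpace Y]
    {μ : Measure Z} {κ κ' : Kernel Z Y} [IsMarkovKernel κ] [IsMarkovKernel κ'] {a d : Z → ℝ}
    (ha : ∀ z, 0 ≤ a z)
    (h : ∀ G, MeasurableSet G → ∀ᵐ z ∂μ, (κ z).real G ≤ a z * (κ' z).real G + d z)
    {f : Z × Y → ℝ} (hf : Measurable f) :
    ∀ᵐ z ∂μ, ∀ B : Set ℝ, MeasurableSet B →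
      (κ z).real {y | f (z, y) ∈ B} ≤ a z * (κ' z).real {y | f (z, y) ∈ B} + d z := by
  obtain ⟨𝒞, h1, h2, h3⟩ := exists_countable_measurable_prod hf
  set m := MeasurableSpace.generateFrom 𝒞 with hm
  have hle : m ≤ mY := MeasurableSpace.generateFrom_le h2
  have hgen : m = MeasurableSpace.generateFrom (generateSetAlgebra 𝒞) :=
    generateFrom_generateSetAlgebra_eq.symm
  have hall : ∀ᵐ z ∂μ, ∀ G ∈ generateSetAlgebra 𝒞,
      (κ z).real G ≤ a z * (κ' z).real G + d z := by
    refine (ae_ball_iff (countable_generateSetAlgebra h1)).2 fun G hG => h G (hle G ?_)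
    rw [hgen]
    exact MeasurableSpace.measurableSet_generateFrom hG
  filter_upwards [hall] with z hz B hB
  have hG : MeasurableSet[m] {y | f (z, y) ∈ B} :=
    (h3.comp (@measurable_prodMk_left _ _ mZ m z)) hB
  have key := @measureReal_le_of_isSetAlgebra Y m ((κ z).trim hle) ((κ' z).trim hle) _ _
    (generateSetAlgebra 𝒞) isSetAlgebra_generateSetAlgebra hgen (a z) (d z) (ha z)
    (fun G hG' => by
      have hGm : MeasurableSet[m] G := by
        rw [hgen]
        exact MeasurableSpace.measurableSet_generateFrom hG'
      simpa only [Measure.real, trim_measurableSet_eq hle hGm] using hz G hG') _ hG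
  simpa only [Measure.real, trim_measurableSet_eq hle hG] using key

/-! ### One conditionally private step -/

section Step

variable {Z Y : Type*} [MeasurableSpace Z] [MeasurableSpace Y]

/-- One step of the backward recursion. `H` and `Φ` are versions of the conditional expectations
`∫ h (z, y) ∂κ z` and `∫ φ (z, y) ∂κ' z`, modified on a `μ`-null and on a `ν`-null set respectively,
such that bounds of `h` in terms of `φ` carry over to `H` and `Φ` for *every* `z`. The
privacy inequality of `κ` holds only `μ`-almost surely and that of `κ'` only `ν`-almost surely, and
neither measure need dominate the other; so `H` is set to `0` where the former fails, and `Φ` to `1`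
where the latter fails, and there the bounds are trivial. -/
lemma exists_conditional_bound {μ ν : Measure Z} [IsProbabilityMeasure μ] [IsProbabilityMeasure ν]
    {κ κ' : Kernel Z Y} [IsMarkovKernel κ] [IsMarkovKernel κ'] {e d : Z → ℝ≥0}
    (hfwd : ∀ G, MeasurableSet G →
      ∀ᵐ z ∂μ, (κ z).real G ≤ Real.exp (e z) * (κ' z).real G + d z)
    (hbwd : ∀ G, MeasurableSet G →
      ∀ᵐ z ∂ν, (κ' z).real G ≤ Real.exp (e z) * (κ z).real G + d z)
    {a b : ℝ} (hab : a.HolderConjugate b) {h φ : Z × Y → ℝ} (hh : Measurable h)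
    (hφ : Measurable φ) (hh0 : ∀ x, 0 ≤ h x) (hh1 : ∀ x, h x ≤ 1) (hφ0 : ∀ x, 0 ≤ φ x)
    (hφ1 : ∀ x, φ x ≤ 1) :
    ∃ H Φ : Z → ℝ, Measurable H ∧ Measurable Φ ∧ (∀ z, 0 ≤ H z) ∧ (∀ z, H z ≤ 1) ∧
      (∀ z, 0 ≤ Φ z) ∧ (∀ z, Φ z ≤ 1) ∧
      ∫ x, h x ∂(μ ⊗ₘ κ) = ∫ z, H z ∂μ ∧ ∫ x, φ x ∂(ν ⊗ₘ κ') = ∫ z, Φ z ∂ν ∧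
      (∀ z r K, 0 ≤ r → 1 ≤ K → (∀ y, h (z, y) ≤ r + K * φ (z, y) ^ (1 / b)) →
        H z ≤ r + d z + Real.exp ((a - 1) * (e z : ℝ) ^ 2 / 2) * K * Φ z ^ (1 / b)) ∧
      (∀ z c, 0 ≤ c → (∀ y, h (z, y) ≤ c) → H z ≤ c) ∧
      (∀ z c, c ≤ 1 → (∀ y, c ≤ φ (z, y)) → c ≤ Φ z) := by
  have hb : 0 < b := hab.symm.pos
  have ha1 : 0 ≤ a - 1 := by linarith [hab.lt]
  obtain ⟨N, hN, hNm, hN0⟩ := exists_measurable_superset_of_null (ae_iff.1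
    (ae_forall_measureReal_preimage_le (fun z => (Real.exp_pos (e z)).le) hfwd hφ))
  obtain ⟨N', hN', hNm', hN0'⟩ := exists_measurable_superset_of_null (ae_iff.1
    (ae_forall_measureReal_preimage_le (fun z => (Real.exp_pos (e z)).le) hbwd hφ))
  have hsec : ∀ {f : Z × Y → ℝ}, Measurable f → ∀ z, Measurable fun y => f (z, y) :=
    fun hf z => hf.comp measurable_prodMk_left
  have hmh : Measurable fun z => ∫ y, h (z, y) ∂κ z :=
    (hh.stronglyMeasurable.integral_kernel_prod_right' (κ := κ)).measurable
  have hmφ : Measurable fun z => ∫ y, φ (z, y) ∂κ' z :=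
    (hφ.stronglyMeasurable.integral_kernel_prod_right' (κ := κ')).measurable
  have hih : ∀ z, Integrable (fun y => h (z, y)) (κ z) := fun z =>
    integrable_of_mem_Icc (hsec hh z) (fun y => hh0 _) (fun y => hh1 _)
  have hiφ : ∀ z, Integrable (fun y => φ (z, y)) (κ' z) := fun z =>
    integrable_of_mem_Icc (hsec hφ z) (fun y => hφ0 _) (fun y => hφ1 _)
  classical
  have hH1 : ∀ z c, (∀ y, h (z, y) ≤ c) → ∫ y, h (z, y) ∂κ z ≤ c := fun z c hc => by
    simpa using integral_mono (hih z) (integrable_const c) hc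
  refine ⟨fun z => if z ∈ N then 0 else ∫ y, h (z, y) ∂κ z,
    fun z => if z ∈ N' then 1 else ∫ y, φ (z, y) ∂κ' z,
    measurable_const.ite hNm hmh, measurable_const.ite hNm' hmφ, ?_, ?_, ?_, ?_, ?_, ?_, ?_, ?_, ?_⟩
  · intro z
    dsimp only
    split_ifs
    · exact le_rfl
    · exact integral_nonneg fun y => hh0 _
  · intro z
    dsimp only
    split_ifs
    · exact zero_le_one
    · exact hH1 z 1 fun y => hh1 _
  · intro z
    dsimp only
    split_ifs
    · exact zero_le_one
    · exact integral_nonneg fun y => hφ0 _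
  · intro z
    dsimp only
    split_ifs
    · exact le_rfl
    · simpa using integral_mono (hiφ z) (integrable_const 1) fun y => hφ1 _
  · rw [Measure.integral_compProd (integrable_of_mem_Icc hh hh0 hh1)]
    refine integral_congr_ae ?_
    filter_upwards [measure_eq_zero_iff_ae_notMem.1 hN0] with z hz
    simp [hz]
  · rw [Measure.integral_compProd (integrable_of_mem_Icc hφ hφ0 hφ1)]
    refine integral_congr_ae ?_
    filter_upwards [measure_eq_zero_iff_ae_notMem.1 hN0'] with z hz
    simp [hz]
  · intro z r K hr hK hle
    have hE1 : 1 ≤ Real.exp ((a - 1) * (e z : ℝ) ^ 2 / 2) := Real.one_le_exp (by positivity)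
    have hd := (d z).coe_nonneg
    have hEK : 1 ≤ Real.exp ((a - 1) * (e z : ℝ) ^ 2 / 2) * K :=
      one_le_mul_of_one_le_of_one_le hE1 hK
    have hI0 : 0 ≤ ∫ y, φ (z, y) ∂κ' z := integral_nonneg fun y => hφ0 _
    by_cases hzN : z ∈ N
    · simp only [hzN, if_true]
      have : (0 : ℝ) ≤ if z ∈ N' then 1 else ∫ y, φ (z, y) ∂κ' z := by
        split_ifs
        · exact zero_le_one
        · exact hI0
      have := Real.rpow_nonneg this (1 / b)
      positivity
    by_cases hzN' : z ∈ N'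
    · simp only [hzN, hzN', if_true, if_false, Real.one_rpow]
      have := hH1 z 1 fun y => hh1 _
      linarith
    simp only [hzN, hzN', if_false]
    have hz := not_not.1 fun hc => hzN (hN hc)
    have hz' := not_not.1 fun hc => hzN' (hN' hc)
    -- Truncation at `1` makes the one-step estimate applicable, and loses nothing as `h ≤ 1`.
    set g : ℝ → ℝ := fun s => min 1 (K * s ^ (1 / b)) with hg
    have hgm : Measurable g := measurable_const.min ((measurable_id.pow_const _).const_mul K)
    have hg0 : ∀ y, 0 ≤ g (φ (z, y)) := fun y =>
      le_min zero_le_one (mul_nonneg (by linarith) (Real.rpow_nonneg (hφ0 _) _))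
    have hg1 : ∀ y, g (φ (z, y)) ≤ 1 := fun y => min_le_left _ _
    have hgφ : Measurable fun y => g (φ (z, y)) := hgm.comp (hsec hφ z)
    have step := integral_le_of_cdf_le (p := κ z) (q := κ' z) hgφ hg0 hg1 (e z).coe_nonneg hd hab
      (fun t => hz _ (hgm measurableSet_Ici)) (fun t => hz' _ (hgm measurableSet_Iic))
    have hpow : ∫ y, g (φ (z, y)) ^ b ∂κ' z ≤ K ^ b * ∫ y, φ (z, y) ∂κ' z := by
      rw [← integral_const_mul]
      refine integral_mono ?_ ((hiφ z).const_mul _) fun y => ?_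
      · exact integrable_of_mem_Icc (hgφ.pow_const b) (fun y => Real.rpow_nonneg (hg0 y) b)
          (fun y => Real.rpow_le_one (hg0 y) (hg1 y) hb.le)
      · refine (Real.rpow_le_rpow (hg0 y) (min_le_right _ _) hb.le).trans_eq ?_
        rw [Real.mul_rpow (by linarith) (Real.rpow_nonneg (hφ0 _) _), ← Real.rpow_mul (hφ0 _),
          one_div_mul_cancel hb.ne', Real.rpow_one]
    have hroot : (∫ y, g (φ (z, y)) ^ b ∂κ' z) ^ (1 / b) ≤
        K * (∫ y, φ (z, y) ∂κ' z) ^ (1 / b) := by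
      refine (Real.rpow_le_rpow (integral_nonneg fun y => Real.rpow_nonneg (hg0 y) b) hpow
        (by positivity)).trans_eq ?_
      rw [Real.mul_rpow (Real.rpow_nonneg (by linarith) _) hI0, ← Real.rpow_mul (by linarith),
        mul_one_div_cancel hb.ne', Real.rpow_one]
    have hint : ∫ y, h (z, y) ∂κ z ≤ r + ∫ y, g (φ (z, y)) ∂κ z := by
      have hig : Integrable (fun y => g (φ (z, y))) (κ z) := integrable_of_mem_Icc hgφ hg0 hg1
      have : ∫ y, h (z, y) ∂κ z ≤ ∫ y, (r + g (φ (z, y))) ∂κ z := by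
        refine integral_mono (hih z) ((integrable_const r).add hig) fun y => ?_
        rcases min_cases 1 (K * φ (z, y) ^ (1 / b)) with ⟨hm, _⟩ | ⟨hm, _⟩
        · simp only [hg, hm]
          linarith [hh1 (z, y)]
        · simp only [hg, hm]
          exact hle y
      refine this.trans_eq ?_
      rw [integral_add (integrable_const r) hig]
      simp
    have := mul_le_mul_of_nonneg_left hroot
      (by linarith : 0 ≤ Real.exp ((a - 1) * (e z : ℝ) ^ 2 / 2))
    rw [mul_assoc]
    linarith
  · intro z c hc hle
    dsimp only
    split_ifs
    · exact hc
    · exact hH1 z c hle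
  · intro z c hc hle
    dsimp only
    split_ifs
    · exact hc
    · simpa using integral_mono (integrable_const c) (hiφ z) hle

end Step

/-! ### Backward recursion along the histories -/

section Adaptive

variable {Y : Type*}

/-- The sum over `m < n` of the values of `f m` at the first `m` entries of the history `z`. -/
def prefixSum (f : ∀ n : ℕ, (Fin n → Y) → ℝ) : ∀ n : ℕ, (Fin n → Y) → ℝ
  | 0, _ => 0
  | n + 1, z => prefixSum f n (Fin.init z) + f n (Fin.init z)

lemma prefixSum_init_le {f : ∀ n : ℕ, (Fin n → Y) → ℝ} (hf : ∀ n z, 0 ≤ f n z) (n : ℕ)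
    (z : Fin (n + 1) → Y) : prefixSum f n (Fin.init z) ≤ prefixSum f (n + 1) z :=
  le_add_of_nonneg_right (hf _ _)

lemma measurable_fin_init [MeasurableSpace Y] (n : ℕ) :
    Measurable fun z : Fin (n + 1) → Y => (Fin.init z : Fin n → Y) :=
  measurable_pi_lambda _ fun i => measurable_pi_apply i.castSucc

lemma measurable_fin_snoc [MeasurableSpace Y] (n : ℕ) :
    Measurable fun x : (Fin n → Y) × Y => (Fin.snoc x.1 x.2 : Fin (n + 1) → Y) := by
  refine measurable_pi_lambda _ fun i => ?_
  refine Fin.lastCases ?_ (fun j => ?_) i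
  · simpa using measurable_snd
  · simpa [Function.comp_def] using (measurable_pi_apply j).comp measurable_fst

lemma measurable_prefixSum [MeasurableSpace Y] {f : ∀ n : ℕ, (Fin n → Y) → ℝ}
    (hf : ∀ n, Measurable (f n)) : ∀ n, Measurable (prefixSum f n)
  | 0 => measurable_const
  | n + 1 => ((measurable_prefixSum hf n).comp (measurable_fin_init n)).add
      ((hf n).comp (measurable_fin_init n))

/-- The parameters of the first `n` algorithms, computed along the history `z`, respect the budgets:
`s` for the sum of the `ε_m ^ 2` and `d` for the sum of the `δ_m`. Membership depends on the first
`n - 1` entries of `z` only. -/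
def WithinBudget (εs δs : ∀ n : ℕ, (Fin n → Y) → ℝ≥0) (s d : ℝ) (n : ℕ) (z : Fin n → Y) : Prop :=
  prefixSum (fun n z => (εs n z : ℝ) ^ 2) n z ≤ s ∧ prefixSum (fun n z => (δs n z : ℝ)) n z ≤ d

lemma WithinBudget.init {εs δs : ∀ n : ℕ, (Fin n → Y) → ℝ≥0} {s d : ℝ} {n : ℕ}
    {z : Fin (n + 1) → Y} (h : WithinBudget εs δs s d (n + 1) z) :
    WithinBudget εs δs s d n (Fin.init z) :=
  ⟨(prefixSum_init_le (fun _ _ => sq_nonneg _) n z).trans h.1,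
    (prefixSum_init_le (fun _ _ => NNReal.coe_nonneg _) n z).trans h.2⟩

lemma measurableSet_withinBudget [MeasurableSpace Y] {εs δs : ∀ n : ℕ, (Fin n → Y) → ℝ≥0}
    (hεs : ∀ n, Measurable (εs n)) (hδs : ∀ n, Measurable (δs n)) (s d : ℝ) (n : ℕ) :
    MeasurableSet {z | WithinBudget εs δs s d n z} :=
  (measurableSet_le (measurable_prefixSum (fun n => (hεs n).coe_nnreal_real.pow_const 2) n)
    measurable_const).inter
  (measurableSet_le (measurable_prefixSum (fun n => (hδs n).coe_nnreal_real) n) measurable_const)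

variable [MeasurableSpace Y] {X : Type*} {Ω : X → Type*} [∀ x, MeasurableSpace (Ω x)]
  {P : ∀ x, Measure (Ω x)} {A : ℕ → ∀ x, Ω x → Y}

lemma measurable_history (hA : ∀ n x, Measurable (A n x)) (n : ℕ) (x : X) :
    Measurable (history A n x) :=
  measurable_pi_lambda _ fun i => hA i x

lemma integral_history_succ (hA : ∀ n x, Measurable (A n x)) {n : ℕ} {x : X}
    {κ : Kernel (Fin n → Y) Y} [IsMarkovKernel κ]
    (hκ : HasCondDistrib (A n x) (history A n x) κ (P x)) {h : (Fin (n + 1) → Y) → ℝ}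
    (hh : Measurable h) :
    ∫ ω, h (history A (n + 1) x ω) ∂P x =
      ∫ p, h (Fin.snoc p.1 p.2) ∂((P x).map (history A n x) ⊗ₘ κ) := by
  rw [← HasLaw.map_eq hκ, integral_map ((measurable_history hA n x).prodMk (hA n x)).aemeasurable
    (f := fun p : (Fin n → Y) × Y => h (Fin.snoc p.1 p.2))
    (hh.comp (measurable_fin_snoc n)).aestronglyMeasurable]
  congr 1 with ω
  congr 1
  exact (Fin.snoc_init_self (history A (n + 1) x ω)).symm

/-- The main estimate for finite histories. While the budgets `s` and `d` last, `h` may exceed a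
multiple of `φ ^ (1 / b)` by the remaining `d`-budget, with a factor determined by the remaining
`s`-budget. From the step on at which a budget is exceeded, nothing more is output: `c` is the
indicator of the event in question, as decided by the output so far, and it separates `h` from
`φ`. -/
theorem integral_history_le [∀ x, IsProbabilityMeasure (P x)] {Nbr : X → X → Prop}
    (hNbr : ∀ x x', Nbr x x' → Nbr x' x)
    (hA : ∀ n x, Measurable (A n x)) {εs δs : ∀ n : ℕ, (Fin n → Y) → ℝ≥0}
    (hεs : ∀ n, Measurable (εs n)) (hδs : ∀ n, Measurable (δs n))
    (hDP : ∀ n, IsCondDP Nbr P (A n) (history A n) (εs n) (δs n))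
    {s d a b : ℝ} (hs : 0 ≤ s) (hd : 0 ≤ d) (hab : a.HolderConjugate b)
    {c : ∀ n : ℕ, (Fin n → Y) → ℝ} (hc01 : ∀ n z, c n z = 0 ∨ c n z = 1)
    (hc : ∀ n z, ¬ WithinBudget εs δs s d (n + 1) z → c (n + 1) z = c n (Fin.init z))
    {x x' : X} (hxx' : Nbr x x') (n : ℕ) :
    ∀ {h φ : (Fin n → Y) → ℝ}, Measurable h → Measurable φ → (∀ z, 0 ≤ h z) → (∀ z, h z ≤ 1) →
      (∀ z, 0 ≤ φ z) → (∀ z, φ z ≤ 1) →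
      (∀ z, WithinBudget εs δs s d n z →
        h z ≤ (d - prefixSum (fun n z => (δs n z : ℝ)) n z) +
          Real.exp ((a - 1) * (s - prefixSum (fun n z => (εs n z : ℝ) ^ 2) n z) / 2) *
            φ z ^ (1 / b)) →
      (∀ z, ¬ WithinBudget εs δs s d n z → h z ≤ c n z ∧ c n z ≤ φ z) →
      ∫ ω, h (history A n x ω) ∂P x ≤
        d + Real.exp ((a - 1) * s / 2) * (∫ ω, φ (history A n x' ω) ∂P x') ^ (1 / b) := by
  have ha1 : 0 ≤ a - 1 := by linarith [hab.lt]
  induction n with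
  | zero =>
    intro h φ hh hφ hh0 hh1 hφ0 hφ1 hin hout
    have e1 : ∀ x (ω : Ω x), history A 0 x ω = Fin.elim0 := fun x ω => Subsingleton.elim _ _
    have := hin Fin.elim0 ⟨hs, hd⟩
    simpa [e1, prefixSum] using this
  | succ n ih =>
    intro h φ hh hφ hh0 hh1 hφ0 hφ1 hin hout
    obtain ⟨κ, hκM, hκ, hκDP⟩ := hDP n
    have hae : ∀ x x', Nbr x x' → ∀ G, MeasurableSet G → ∀ᵐ z ∂(P x).map (history A n x),
        (κ x z).real G ≤ Real.exp (εs n z) * (κ x' z).real G + δs n z := by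
      intro x x' hx G hG
      have hm : ∀ x, Measurable fun z => (κ x z).real G := fun x =>
        (Kernel.measurable_coe _ hG).ennreal_toReal
      refine (ae_map_iff (measurable_history hA n x).aemeasurable (measurableSet_le (hm x)
        ((((hεs n).coe_nnreal_real.exp).mul (hm x')).add (hδs n).coe_nnreal_real))).2 ?_
      exact hκDP x x' hx G hG
    have hpx : ∀ x, IsProbabilityMeasure ((P x).map (history A n x)) := fun x =>
      Measure.isProbabilityMeasure_map (measurable_history hA n x).aemeasurable
    obtain ⟨H, Φ, hH, hΦ, hH0, hH1, hΦ0, hΦ1, hHint, hΦint, hact, hle, hge⟩ :=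
      exists_conditional_bound (hae x x' hxx') (hae x' x (hNbr x x' hxx')) hab
        (hh.comp (measurable_fin_snoc n)) (hφ.comp (measurable_fin_snoc n)) (fun _ => hh0 _)
        (fun _ => hh1 _) (fun _ => hφ0 _) (fun _ => hφ1 _)
    rw [integral_history_succ hA (hκ x) hh, integral_history_succ hA (hκ x') hφ]
    simp only [Function.comp_apply] at hHint hΦint hact hle hge
    rw [hHint, hΦint, integral_map (measurable_history hA n x).aemeasurable
      hH.aestronglyMeasurable, integral_map (measurable_history hA n x').aemeasurable
      hΦ.aestronglyMeasurable]
    have hS : ∀ f : ∀ n : ℕ, (Fin n → Y) → ℝ, ∀ (z : Fin n → Y) (y : Y),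
        prefixSum f (n + 1) (Fin.snoc z y) = prefixSum f n z + f n z := fun f z y => by
      simp [prefixSum]
    have hhalt : ∀ z, (∀ y, ¬ WithinBudget εs δs s d (n + 1) (Fin.snoc z y : Fin (n + 1) → Y)) →
        H z ≤ c n z ∧ c n z ≤ Φ z := by
      intro z hz
      have hcz : ∀ y, c (n + 1) (Fin.snoc z y : Fin (n + 1) → Y) = c n z := fun y => by
        rw [hc n _ (hz y)]
        simp
      refine ⟨hle z _ ?_ fun y => ?_, hge z _ ?_ fun y => ?_⟩
      · rcases hc01 n z with h | h <;> simp [h]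
      · exact (hout _ (hz y)).1.trans_eq (hcz y)
      · rcases hc01 n z with h | h <;> simp [h]
      · exact (hcz y).symm.trans_le (hout _ (hz y)).2
    refine ih hH hΦ hH0 hH1 hΦ0 hΦ1 (fun z hz => ?_) fun z hz => hhalt z fun y hy => hz ?_
    · by_cases hz1 : prefixSum (fun n z => (εs n z : ℝ) ^ 2) n z + (εs n z : ℝ) ^ 2 ≤ s ∧
          prefixSum (fun n z => (δs n z : ℝ)) n z + δs n z ≤ d
      · have hK : 1 ≤ Real.exp ((a - 1) * (s - (prefixSum (fun n z => (εs n z : ℝ) ^ 2) n z +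
            (εs n z : ℝ) ^ 2)) / 2) :=
          Real.one_le_exp (div_nonneg (mul_nonneg ha1 (by linarith [hz1.1])) zero_le_two)
        have := hact z (d - (prefixSum (fun n z => (δs n z : ℝ)) n z + δs n z)) _
          (by linarith [hz1.2]) hK fun y => by
            have := hin (Fin.snoc z y) (by rwa [WithinBudget, hS, hS])
            rwa [hS, hS] at this
        rw [← Real.exp_add] at this
        refine this.trans_eq ?_
        congr 1
        · ring
        · congr 2; ring
      · obtain ⟨h1, h2⟩ := hhalt z fun y => by rwa [WithinBudget, hS, hS]
        have hK : 1 ≤ Real.exp ((a - 1) * (s - prefixSum (fun n z => (εs n z : ℝ) ^ 2) n z) / 2) :=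
          Real.one_le_exp (div_nonneg (mul_nonneg ha1 (by linarith [hz.1])) zero_le_two)
        have hz2 := hz.2
        rcases hc01 n z with h | h
        · rw [h] at h1
          have := Real.rpow_nonneg (hΦ0 z) (1 / b)
          have := mul_nonneg (zero_le_one.trans hK) this
          linarith
        · rw [h] at h1 h2
          rw [le_antisymm (hΦ1 z) h2, Real.one_rpow]
          linarith
    · simpa using hy.init

end Adaptive

/-! ### The choice of the exponent -/

/-- The conversion of the moment bound to an `(ε, δ')`-bound by weighted AM–GM, for
`ε = g * r + r ^ 2 / 2` and `δ' = exp (-(g ^ 2 / 2))`. With the Hölder exponent `1 + g / r` the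
weighted geometric mean of `exp ε * Q` and `δ'` is exactly the left-hand side. -/
lemma exp_mul_rpow_le {g r Q : ℝ} (hg : 0 < g) (hr : 0 < r) (hQ : 0 ≤ Q) :
    Real.exp (g / r * r ^ 2 / 2) * Q ^ (g / r / (1 + g / r)) ≤
      Real.exp (g * r + r ^ 2 / 2) * Q + Real.exp (-(g ^ 2 / 2)) := by
  set l := g / r with hl
  have hl0 : 0 < l := div_pos hg hr
  have hgl : g = l * r := by rw [hl]; field_simp
  have hw1 : 0 ≤ l / (1 + l) := by positivity
  have hw2 : 0 ≤ 1 / (1 + l) := by positivity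
  have hw : l / (1 + l) + 1 / (1 + l) = 1 := by field_simp; ring
  have key := Real.geom_mean_le_arith_mean2_weighted hw1 hw2
    (mul_nonneg (Real.exp_pos (g * r + r ^ 2 / 2)).le hQ) (Real.exp_pos (-(g ^ 2 / 2))).le hw
  have hE := (Real.exp_pos (g * r + r ^ 2 / 2)).le
  have hM := (Real.exp_pos (-(g ^ 2 / 2))).le
  have h1 : l / (1 + l) * (Real.exp (g * r + r ^ 2 / 2) * Q) ≤
      Real.exp (g * r + r ^ 2 / 2) * Q :=
    mul_le_of_le_one_left (mul_nonneg hE hQ) (by linarith)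
  have h2 : 1 / (1 + l) * Real.exp (-(g ^ 2 / 2)) ≤ Real.exp (-(g ^ 2 / 2)) :=
    mul_le_of_le_one_left hM (by linarith)
  refine le_trans (le_of_eq ?_) (key.trans (add_le_add h1 h2))
  rw [Real.mul_rpow hE hQ, mul_right_comm, ← Real.exp_mul, ← Real.exp_mul, ← Real.exp_add]
  congr 2
  rw [hgl]
  field_simp
  ring

/-- The `ε`-part of the stopping rule compares `∑ ε_m ^ 2` with `r ^ 2`, where `r` is the
positive root of `g * r + r ^ 2 / 2 = ε` and `g = √(2 log (1 / δ'))`. -/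
lemma exists_radius {ε δ' : ℝ} (hε : 0 < ε) (h0 : 0 < δ') (h1 : δ' < 1) :
    ∃ g r, 0 < g ∧ 0 < r ∧ g * r + r ^ 2 / 2 = ε ∧ Real.exp (-(g ^ 2 / 2)) = δ' ∧
      ∀ S, 0 ≤ S → (√(2 * Real.log (1 / δ') * S) + 1 / 2 * S ≤ ε ↔ S ≤ r ^ 2) := by
  have hl : 0 < 2 * Real.log (1 / δ') :=
    mul_pos two_pos (Real.log_pos ((one_lt_div h0).2 h1))
  set g := √(2 * Real.log (1 / δ')) with hg
  have hg0 : 0 < g := Real.sqrt_pos.2 hl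
  have hg2 : g ^ 2 = 2 * Real.log (1 / δ') := Real.sq_sqrt hl.le
  have hr : g < √(g ^ 2 + 2 * ε) := Real.lt_sqrt_of_sq_lt (by linarith)
  have hr2 : √(g ^ 2 + 2 * ε) ^ 2 = g ^ 2 + 2 * ε := Real.sq_sqrt (by positivity)
  have hr0 : 0 < √(g ^ 2 + 2 * ε) - g := sub_pos.2 hr
  have hre : g * (√(g ^ 2 + 2 * ε) - g) + (√(g ^ 2 + 2 * ε) - g) ^ 2 / 2 = ε := by
    linear_combination hr2 / 2
  refine ⟨g, √(g ^ 2 + 2 * ε) - g, hg0, hr0, hre, ?_, fun S hS => ?_⟩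
  · rw [hg2, mul_div_cancel_left₀ _ two_ne_zero, one_div, Real.log_inv, neg_neg, Real.exp_log h0]
  · generalize √(g ^ 2 + 2 * ε) - g = r at hr0 hre
    rw [Real.sqrt_mul hl.le, ← hg]
    obtain ⟨t, ht, rfl⟩ : ∃ t, 0 ≤ t ∧ S = t ^ 2 := ⟨√S, Real.sqrt_nonneg S, (Real.sq_sqrt hS).symm⟩
    rw [Real.sqrt_sq ht, sq_le_sq₀ ht hr0.le, ← hre]
    constructor
    · intro h
      by_contra! hlt
      nlinarith [mul_pos hg0 (sub_pos.2 hlt)]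
    · intro h
      nlinarith [mul_nonneg hg0.le (sub_nonneg.2 h)]

/-! ### The stopping rule and the stopped output -/

lemma lt_filterTime_iff {ε δ' δ'' : ℝ} {e d : ℕ → ℝ≥0} {n : ℕ} :
    (n : ℕ∞) < filterTime ε δ' δ'' e d ↔ ∀ k ≤ n,
      √(2 * Real.log (1 / δ') * ∑ m ∈ Finset.range (k + 1), (e m : ℝ) ^ 2)
        + 1 / 2 * ∑ m ∈ Finset.range (k + 1), (e m : ℝ) ^ 2 ≤ ε ∧
      ∑ m ∈ Finset.range (k + 1), (d m : ℝ) ≤ δ'' := by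
  rw [filterTime, ← ENat.add_one_le_iff (ENat.natCast_ne_top n), le_sInf_iff]
  simp only [Set.forall_mem_image, Set.mem_ofPred_eq]
  refine forall_congr' fun k => ?_
  rw [ENat.add_one_le_iff (ENat.natCast_ne_top n), Nat.cast_lt, ← not_imp_not, not_lt, not_or,
    not_lt, not_lt]

section Adaptive

variable {Y : Type*} {X : Type*} {Ω : X → Type*} {A : ℕ → ∀ x, Ω x → Y}
  {εs δs : ∀ n : ℕ, (Fin n → Y) → ℝ≥0}

lemma prefixSum_history (f : ∀ n : ℕ, (Fin n → Y) → ℝ) (x : X) (ω : Ω x) (n : ℕ) :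
    prefixSum f n (history A n x ω) = ∑ m ∈ Finset.range n, f m (history A m x ω) := by
  induction n with
  | zero => rfl
  | succ n ih =>
    rw [Finset.sum_range_succ, ← ih]
    rfl

/-- The sums of the parameters are nondecreasing, so the last of the conditions in
`lt_filterTime_iff` implies the others. -/
lemma lt_adaptiveTime_iff {ε δ' δ'' s : ℝ}
    (hs : ∀ S, 0 ≤ S → (√(2 * Real.log (1 / δ') * S) + 1 / 2 * S ≤ ε ↔ S ≤ s))
    (x : X) (ω : Ω x) (n : ℕ) :
    (n : ℕ∞) < adaptiveTime A εs δs (filterTime ε δ' δ'') x ω ↔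
      WithinBudget εs δs s δ'' (n + 1) (history A (n + 1) x ω) := by
  rw [adaptiveTime, lt_filterTime_iff, WithinBudget, prefixSum_history, prefixSum_history]
  have hs' : ∀ k, _ := fun k : ℕ => hs (∑ m ∈ Finset.range k, (εs m (history A m x ω) : ℝ) ^ 2)
    (Finset.sum_nonneg fun m _ => sq_nonneg _)
  simp only [hs']
  refine ⟨fun h => h n le_rfl, fun h k hk => ⟨le_trans ?_ h.1, le_trans ?_ h.2⟩⟩
  · exact Finset.sum_le_sum_of_subset_of_nonneg
      (Finset.range_mono (Nat.succ_le_succ hk)) fun _ _ _ => sq_nonneg _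
  · exact Finset.sum_le_sum_of_subset_of_nonneg
      (Finset.range_mono (Nat.succ_le_succ hk)) fun _ _ _ => NNReal.coe_nonneg _

open Classical in
/-- The stopped output sequence as far as it is determined by the history `z` of length `n`: all
entries from `n` on, or from the step on at which a budget is exceeded, are the terminating
symbol. -/
noncomputable def truncatedOutput (εs δs : ∀ n : ℕ, (Fin n → Y) → ℝ≥0) (s d : ℝ) :
    ∀ n : ℕ, (Fin n → Y) → ℕ → Y ⊕ Unit
  | 0, _ => fun _ => Sum.inr ()
  | n + 1, z => if WithinBudget εs δs s d (n + 1) z then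
      Function.update (truncatedOutput εs δs s d n (Fin.init z)) n (Sum.inl (z (Fin.last n)))
    else truncatedOutput εs δs s d n (Fin.init z)

lemma truncatedOutput_history {s d : ℝ} {x : X} {ω : Ω x} {N : ℕ∞}
    (hN : ∀ n : ℕ, (n : ℕ∞) < N ↔ WithinBudget εs δs s d (n + 1) (history A (n + 1) x ω))
    (n m : ℕ) :
    truncatedOutput εs δs s d n (history A n x ω) m =
      if m < n ∧ (m : ℕ∞) < N then Sum.inl (A m x ω) else Sum.inr () := by
  induction n with
  | zero => simp [truncatedOutput]
  | succ n ih =>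
    rw [truncatedOutput, ← hN n]
    have hinit : (Fin.init (history A (n + 1) x ω) : Fin n → Y) = history A n x ω := rfl
    rw [hinit]
    rcases lt_trichotomy m n with h | rfl | h
    · split_ifs <;> simp_all [Function.update_of_ne h.ne, h.trans n.lt_succ_self]
    · by_cases hm : (m : ℕ∞) < N <;> simp [hm, ih, history]
    · have h1 : ¬ m < n + 1 := by omega
      split_ifs <;> simp_all [Function.update_of_ne h.ne', h.not_gt]

variable [MeasurableSpace Y]

lemma measurable_truncatedOutput (hεs : ∀ n, Measurable (εs n)) (hδs : ∀ n, Measurable (δs n))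
    (s d : ℝ) : ∀ n, Measurable (truncatedOutput εs δs s d n)
  | 0 => measurable_const
  | n + 1 => by
    have ih := (measurable_truncatedOutput hεs hδs s d n).comp (measurable_fin_init n)
    refine Measurable.ite (measurableSet_withinBudget hεs hδs s d (n + 1)) ?_ ih
    refine measurable_pi_lambda _ fun m => ?_
    by_cases h : m = n
    · subst h
      simpa [Function.comp_def] using measurable_inl.comp (measurable_pi_apply (Fin.last m))
    · simpa [Function.update_of_ne h, Function.comp_def] using (measurable_pi_apply m).comp ih

variable [∀ x, MeasurableSpace (Ω x)]

lemma measurable_history_naturalFiltration (hA : ∀ n x, Measurable (A n x)) {m n : ℕ}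
    (hmn : m ≤ n) (x : X) :
    Measurable[naturalFiltration (fun n => A n x) (fun n => hA n x) n] (history A m x) := by
  refine @measurable_pi_lambda _ _ _ (_) _ _ fun i => ?_
  refine Measurable.mono (comap_measurable (A i x)) ?_ le_rfl
  exact le_iSup (fun j : Fin n => MeasurableSpace.comap (A j x) inferInstance) (Fin.castLE hmn i)

lemma isStoppingTime_adaptiveTime (hA : ∀ n x, Measurable (A n x))
    (hεs : ∀ n, Measurable (εs n)) (hδs : ∀ n, Measurable (δs n)) (ε δ' δ'' : ℝ) (x : X) :
    IsStoppingTime (naturalFiltration (fun n => A n x) fun n => hA n x)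
      (adaptiveTime A εs δs (filterTime ε δ' δ'') x) := by
  intro n
  have : {ω | adaptiveTime A εs δs (filterTime ε δ' δ'') x ω ≤ (n : ℕ∞)}ᶜ =
      ⋂ k : Fin (n + 1), ({ω | √(2 * Real.log (1 / δ') *
          ∑ m ∈ Finset.range (k + 1), (εs m (history A m x ω) : ℝ) ^ 2)
        + 1 / 2 * ∑ m ∈ Finset.range (k + 1), (εs m (history A m x ω) : ℝ) ^ 2 ≤ ε} ∩
      {ω | ∑ m ∈ Finset.range (k + 1), (δs m (history A m x ω) : ℝ) ≤ δ''}) := by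
    ext ω
    simp only [Set.mem_compl_iff, Set.mem_ofPred_eq, not_le, adaptiveTime, lt_filterTime_iff,
      Set.mem_iInter, Set.mem_inter_iff, Fin.forall_iff, Nat.lt_succ_iff]
  refine MeasurableSet.of_compl ?_
  refine this ▸ MeasurableSet.iInter fun k => ?_
  have hk : ∀ m ∈ Finset.range ((k : ℕ) + 1), m ≤ n := fun m hm => by
    have := Finset.mem_range.1 hm
    omega
  have h1 : Measurable[naturalFiltration (fun n => A n x) (fun n => hA n x) n] fun ω =>
      ∑ m ∈ Finset.range ((k : ℕ) + 1), (εs m (history A m x ω) : ℝ) ^ 2 :=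
    Finset.measurable_fun_sum _ fun m hm => ((hεs m).coe_nnreal_real.pow_const 2).comp
      (measurable_history_naturalFiltration hA (hk m hm) x)
  have h2 : Measurable[naturalFiltration (fun n => A n x) (fun n => hA n x) n] fun ω =>
      ∑ m ∈ Finset.range ((k : ℕ) + 1), (δs m (history A m x ω) : ℝ) :=
    Finset.measurable_fun_sum _ fun m hm => (hδs m).coe_nnreal_real.comp
      (measurable_history_naturalFiltration hA (hk m hm) x)
  exact MeasurableSet.inter (measurableSet_le ((h1.const_mul _).sqrt.add (h1.const_mul _))
    measurable_const) (measurableSet_le h2 measurable_const)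

lemma measurable_stoppedOutput_of_isStoppingTime {Ω : Type*} [MeasurableSpace Ω] {A : ℕ → Ω → Y}
    (hA : ∀ n, Measurable (A n)) {ℱ : Filtration ℕ ‹MeasurableSpace Ω›} {N : Ω → ℕ∞}
    (hN : IsStoppingTime ℱ N) : Measurable (stoppedOutput A N) := by
  refine measurable_pi_lambda _ fun n => ?_
  refine Measurable.ite ?_ (measurable_inl.comp (hA n)) measurable_const
  have := (ℱ.le n _ (hN n)).compl
  convert this using 1
  ext ω
  exact (not_le (α := ℕ∞)).symm

lemma isSetAlgebra_measurableCylinders {ι : Type*} (E : ι → Type*) [∀ i, MeasurableSpace (E i)] :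
    IsSetAlgebra (measurableCylinders E) where
  empty_mem := empty_mem_measurableCylinders E
  compl_mem _ hs := compl_mem_measurableCylinders hs
  union_mem _ _ hs ht := union_mem_measurableCylinders hs ht

/-! ### Privacy of the stopped output -/

/-- Cylinder sets are events about finite histories, covered by `integral_history_le`; they form an
algebra that generates the product σ-algebra, so the inequality extends to all events. -/
lemma isDP_stoppedOutput {Nbr : X → X → Prop} (hNbr : ∀ x x', Nbr x x' → Nbr x' x)
    {P : ∀ x, Measure (Ω x)} [∀ x, IsProbabilityMeasure (P x)]
    (hA : ∀ n x, Measurable (A n x))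
    (hεs : ∀ n, Measurable (εs n)) (hδs : ∀ n, Measurable (δs n))
    (hDP : ∀ n, IsCondDP Nbr P (A n) (history A n) (εs n) (δs n))
    {ε δ' δ'' : ℝ} (hε : 0 < ε) (hδ' : 0 < δ') (hδ'1 : δ' < 1) (hδ'' : 0 ≤ δ'') :
    IsDP Nbr P (fun x => stoppedOutput (fun n => A n x)
      (adaptiveTime A εs δs (filterTime ε δ' δ'') x)) ε (δ' + δ'') := by
  intro x x' hxx' G hG
  obtain ⟨g, r, hg, hr, hgr, hgδ, hS⟩ := exists_radius hε hδ' hδ'1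
  have hmeas : ∀ x, Measurable (stoppedOutput (fun n => A n x)
      (adaptiveTime A εs δs (filterTime ε δ' δ'') x)) := fun x =>
    measurable_stoppedOutput_of_isStoppingTime (fun n => hA n x)
      (isStoppingTime_adaptiveTime hA hεs hδs ε δ' δ'' x)
  set O := fun x => stoppedOutput (fun n => A n x)
      (adaptiveTime A εs δs (filterTime ε δ' δ'') x) with hO
  suffices h : ((P x).map (O x)).real G ≤ Real.exp ε * ((P x').map (O x')).real G + (δ' + δ'') by
    rwa [map_measureReal_apply (hmeas x) hG, map_measureReal_apply (hmeas x') hG] at h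
  refine measureReal_le_of_isSetAlgebra (isSetAlgebra_measurableCylinders _)
    generateFrom_measurableCylinders.symm (Real.exp_pos ε).le (fun C hC => ?_) hG
  have hCm : MeasurableSet C := MeasurableSet.of_mem_measurableCylinders hC
  rw [map_measureReal_apply (hmeas x) hCm, map_measureReal_apply (hmeas x') hCm]
  set tr := truncatedOutput εs δs (r ^ 2) δ'' with htr
  have htrm : ∀ n, Measurable (tr n) := measurable_truncatedOutput hεs hδs _ _
  obtain ⟨T, hT⟩ : ∃ T, ∀ x, O x ⁻¹' C = (history A T x) ⁻¹' (tr T ⁻¹' C) := by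
    rw [measurableCylinders_nat] at hC
    simp only [Set.mem_iUnion, Set.mem_singleton_iff] at hC
    obtain ⟨T, S, hS', rfl⟩ := hC
    refine ⟨T + 1, fun x => ?_⟩
    ext ω
    simp only [Set.mem_preimage, mem_cylinder]
    suffices h : (Finset.Iic T).restrict (O x ω) =
        (Finset.Iic T).restrict (tr (T + 1) (history A (T + 1) x ω)) by rw [h]
    ext1 ⟨m, hm⟩
    have hm' : m < T + 1 := Nat.lt_succ_of_le (Finset.mem_Iic.1 hm)
    simp only [Finset.restrict, hO, htr, stoppedOutput,
      truncatedOutput_history (fun n => lt_adaptiveTime_iff hS x ω n), hm', true_and]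
  set l := g / r with hl
  have hl0 : 0 < l := div_pos hg hr
  have hab : (1 + l).HolderConjugate ((1 + l) / l) := by
    refine Real.holderConjugate_iff.2 ⟨by linarith, ?_⟩
    field_simp
  have hcm : ∀ n, MeasurableSet (tr n ⁻¹' C) := fun n => htrm n hCm
  have hc01 : ∀ n (z : Fin n → Y), (tr n ⁻¹' C).indicator (fun _ => (1 : ℝ)) z = 0 ∨
      (tr n ⁻¹' C).indicator (fun _ => (1 : ℝ)) z = 1 := fun n z =>
    Set.indicator_eq_zero_or_self _ _ _
  have h0 : ∀ n (z : Fin n → Y), 0 ≤ (tr n ⁻¹' C).indicator (fun _ => (1 : ℝ)) z := fun n z => by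
    rcases hc01 n z with h | h <;> simp [h]
  have h1 : ∀ n (z : Fin n → Y), (tr n ⁻¹' C).indicator (fun _ => (1 : ℝ)) z ≤ 1 := fun n z => by
    rcases hc01 n z with h | h <;> simp [h]
  have hprob : ∀ x, ∫ ω, (tr T ⁻¹' C).indicator (fun _ => (1 : ℝ)) (history A T x ω) ∂P x =
      (P x).real (O x ⁻¹' C) := fun x => by
    rw [hT x, ← integral_indicator_one (measurable_history hA T x (hcm T))]
    rfl
  have key := integral_history_le hNbr hA hεs hδs hDP (sq_nonneg r) hδ'' hab
    (c := fun n => (tr n ⁻¹' C).indicator fun _ => (1 : ℝ)) hc01 (fun n z hz => ?_) hxx' T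
    (measurable_const.indicator (hcm T)) (measurable_const.indicator (hcm T)) (h0 T) (h1 T) (h0 T)
    (h1 T) (fun z hz => ?_) (fun z _ => ⟨le_rfl, le_rfl⟩)
  · rw [hprob, hprob] at key
    have hy := exp_mul_rpow_le hg hr (Q := (P x').real (O x' ⁻¹' C)) measureReal_nonneg
    rw [hgr, hgδ] at hy
    rw [one_div_div, add_sub_cancel_left] at key
    linarith
  · have : tr (n + 1) z = tr n (Fin.init z) := if_neg hz
    exact congrArg (C.indicator fun _ => (1 : ℝ)) this
  · have hK : 1 ≤ Real.exp ((1 + l - 1) *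
        (r ^ 2 - prefixSum (fun n z => (εs n z : ℝ) ^ 2) T z) / 2) :=
      Real.one_le_exp (div_nonneg (mul_nonneg (by linarith) (by linarith [hz.1])) zero_le_two)
    have hz2 := hz.2
    rcases hc01 T z with h | h
    · rw [h, Real.zero_rpow (by positivity)]
      linarith
    · rw [h, Real.one_rpow]
      linarith

end Adaptive
end DiffPriv

theorem theorem1
    {X : Type*} (Nbr : X → X → Prop) (hNbr : ∀ x x', Nbr x x' → Nbr x' x)
    {Ω : X → Type*} [∀ x, MeasurableSpace (Ω x)]
    (P : ∀ x, Measure (Ω x)) [∀ x, IsProbabilityMeasure (P x)]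
    {Y : Type*} [MeasurableSpace Y]
    (A : ℕ → ∀ x, Ω x → Y) (hA : ∀ n x, Measurable (A n x))
    (εs δs : ∀ n : ℕ, (Fin n → Y) → ℝ≥0)
    (hεs : ∀ n, Measurable (εs n)) (hδs : ∀ n, Measurable (δs n))
    (hDP : ∀ n, DiffPriv.IsCondDP Nbr P (A n) (DiffPriv.history A n) (εs n) (δs n))
    (ε δ δ' δ'' : ℝ) (hε : 0 < ε) (hδ' : 0 < δ') (hδ'' : 0 ≤ δ'') (hδ : δ = δ' + δ'') :
    DiffPriv.IsPrivacyFilter Nbr P A hA εs δs ε δ (DiffPriv.filterTime ε δ' δ'') := by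
  have hhalt := DiffPriv.isStoppingTime_adaptiveTime hA hεs hδs ε δ' δ''
  refine ⟨hhalt, fun x => DiffPriv.measurable_stoppedOutput_of_isStoppingTime (fun n => hA n x)
    (hhalt x), ?_⟩
  rcases lt_or_ge δ' 1 with h1 | h1
  · rw [hδ]
    exact DiffPriv.isDP_stoppedOutput hNbr hA hεs hδs hDP hε hδ' h1 hδ''
  · -- For `δ' ≥ 1` every algorithm is `(ε, δ)`-private, since probabilities are at most `1`.
    intro x x' _ G _
    have := mul_nonneg (Real.exp_pos ε).le (measureReal_nonneg (μ := P x')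
      (s := DiffPriv.stoppedOutput (fun n => A n x')
        (DiffPriv.adaptiveTime A εs δs (DiffPriv.filterTime ε δ' δ'') x') ⁻¹' G))
    exact measureReal_le_one.trans (by linarith)
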